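/- **Theorem ($\Lambda_n$ versus $\Omega_n$).** *Definitions.* The Lucas cube $\Lambda_n$ is the graph whose vertices are the binary strings $u_1\cdots u_n$ in which no two cyclically consecutive entries are both $1$ (that is, there is no $i$ with $u_i=u_{i+1}=1$, indices modulo $n$), two strings being adjacent when they differ in exactly one position. A *lucasene* with $n$ hexagons is a chain $h_1,\dots,h_n$ of distinct hexagons of the regular hexagonal tiling of the plane, two of which share an edge exactly when they are consecutive, in which $h_1,h_2,h_3$ are linearly attached (if $n\ge 3$) and no other three consecutive hexagons are. Colour the vertices of the tiling properly black and white; the *directed inner dual graph* has an arc from $h_i$ to $h_j$ if they share an edge whose white end lies on the right when it is crossed from $h_i$ to $h_j$. An *$L$-fence* $\Xi_n$ is a poset whose Hasse diagram (with arcs from an element to the elements that it covers) is isomorphic to the directed inner dual graph of a lucasene with $n$ hexagons; explicitly, up to duality, it is $\{x_1,\dots,x_n\}$ with the covering relations $x_1>x_2>x_3<x_4>x_5<\cdots$. Let $\Omega_n$ be the finite distributive lattice of all filters (up-sets, including $\emptyset$) of $\Xi_n$ ordered by reverse inclusion; its undirected Hasse diagram is also denoted by $\Omega_n$. *Statement.*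 Let $n\ge 2$ and let $\Xi_n$ be any $L$-fence with $n$ elements. 1. For every $k\ge 0$, the graphs $\Lambda_n$ and $\Omega_n$ have the same number of induced subgraphs isomorphic to the $k$-dimensional hypercube. 2. If $n\ge 3$, then the graphs $\Lambda_n$ and $\Omega_n$ are not isomorphic. 3. If $n=2m$ with $m\ge 1$, then $\Lambda_{2m}$ can be oriented as the Hasse diagram of a finite distributive lattice $L$; if $m\ge 2$, then such an $L$ is not isomorphic to the lattice $\Omega_{2m}$. 4. If $n=2m+1$ with $m\ge 1$, then $\Lambda_{2m+1}$ is not isomorphic to the undirected Hasse diagram of any finite distributive lattice. -/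

import Mathlib

/-- The `k`-dimensional hypercube: binary strings of length `k`, adjacent when they differ in
exactly one position. -/
def hypercube (k : ℕ) : SimpleGraph (Fin k → Bool) where
  Adj u v := hammingDist u v = 1
  symm := ⟨fun u v h => by rw [hammingDist_comm]; exact h⟩
  loopless := ⟨fun u h => by simp at h⟩

/-- Lucas strings of length `n`: binary strings without two cyclically consecutive ones. -/
def IsLucasString {n : ℕ} (u : Fin n → Bool) : Prop :=
  ∀ i j : Fin n, (j : ℕ) = ((i : ℕ) + 1) % n → ¬ (u i = true ∧ u j = true)

/-- The Lucas cube `Λ_n`: the subgraph of the `n`-cube induced by the Lucas strings. -/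
def lucasCube (n : ℕ) : SimpleGraph {u : Fin n → Bool // IsLucasString u} :=
  (hypercube n).induce {u | IsLucasString u}

/-- The number of `k`-dimensional induced hypercubes of `G`: the number of vertex sets whose
induced subgraph is isomorphic to the `k`-cube. -/
noncomputable def inducedCubeCount {V : Type*} (G : SimpleGraph V) (k : ℕ) : ℕ :=
  {S : Set V | Nonempty (G.induce S ≃g hypercube k)}.ncard

/-- The cells of the regular hexagonal tiling of the plane, in axial coordinates: `(a, b)` is the
hexagon with centre `a • e + b • e'`, where `e, e'` have equal length and `e'` is `e` rotated by
60 degrees counterclockwise. -/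
abbrev HexCell : Type := ℤ × ℤ

/-- There is an arc from `c` to `d` in the directed inner dual: the hexagons `c` and `d` share an
edge, and when this edge is crossed from `c` to `d` its white end lies on the right.
Each vertex of the tiling is the common corner of three hexagons, it is black if these are
`p, p + (1, 0), p + (0, 1)` and white if they are `p, p - (1, 0), p - (0, 1)`, for some `p`;
this is a proper 2-colouring. -/
def HexArc (c d : HexCell) : Prop :=
  d - c = (1, 0) ∨ d - c = (-1, 1) ∨ d - c = (0, -1)

/-- Two hexagons share an edge. -/
def HexAdj (c d : HexCell) : Prop := HexArc c d ∨ HexArc d c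

/-- `h 0, …, h (n-1)` are the successive hexagons of a hexagonal chain: they are distinct, and two
of them share an edge exactly when they are consecutive. -/
structure IsHexChain {n : ℕ} (h : Fin n → HexCell) : Prop where
  injective : Function.Injective h
  adj_iff : ∀ i j : Fin n, HexAdj (h i) (h j) ↔ ((i : ℕ) + 1 = j ∨ (j : ℕ) + 1 = i)

/-- Lucasenes: hexagonal chains in which the first three hexagons are linearly attached and no
other three consecutive hexagons are. (Any chain with at most two hexagons qualifies.) -/
structure IsLucasene {n : ℕ} (h : Fin n → HexCell) : Prop extends IsHexChain h where
  linear_iff : ∀ i j k : Fin n, (i : ℕ) + 1 = j → (j : ℕ) + 1 = k →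
    (h k - h j = h j - h i ↔ (i : ℕ) = 0)

/-- `Ξ` is an `L`-fence `Ξ_n`: its Hasse diagram, with arcs going from an element to the elements
it covers, is isomorphic to the directed inner dual graph of a lucasene with `n` hexagons. -/
def IsLFence (n : ℕ) (Ξ : Type*) [PartialOrder Ξ] : Prop :=
  ∃ h : Fin n → HexCell, IsLucasene h ∧
    ∃ e : Fin n ≃ Ξ, ∀ i j : Fin n, e j ⋖ e i ↔ HexArc (h i) (h j)

/-- The matchable Lucas distributive lattice `Ω_n` of an `L`-fence `Ξ = Ξ_n`: all filters (up-sets,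
including the empty one) of `Ξ`, ordered by reverse inclusion. -/
abbrev MatchableLucasLattice (Ξ : Type*) [PartialOrder Ξ] : Type _ := UpperSet Ξ

/-!
Replacing strings by the sets of their ones turns `Λ_n` into the graph of independent sets of the
cycle `C_n`, and the Hasse diagrams of distributive lattices into families of lower sets of posets.
Both sit as induced subgraphs in a cube graph on subsets, where every induced `k`-cube is an
interval `[s \ t, s]` with `|t| = k`. Counting cubes by their top `s`, the independent sets of a
graph contribute `|s| choose k`, and the lower sets of a poset `P` contribute
`|max s| choose k`; as lower sets correspond to antichains through their maximal elements, `Ω_n` has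
as many `k`-cubes as the graph of independent sets of the comparability graph of `Ξ_n`. That graph
is the tadpole obtained from the path `0, 1, …, n - 1` by adding the edge `{0, 2}`, which has as
many independent sets of each size as `C_n`.

The graph of independent sets of a finite graph `H` is the Hasse diagram of a distributive lattice
exactly when `H` is bipartite. If `K` is one side of a bipartition, then `s ↦ K ∆ s` takes the
independent sets to the lower sets of a poset of height two. Conversely, every element of a finite
distributive lattice lies on a geodesic from bottom to top, hence every independent set lies
between the intersection and the union of the two independent sets representing these; applied to
the empty set and to the singletons, this makes them a bipartition of `H`.
-/

section CubeGraph

open SimpleGraph Set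
open scoped symmDiff

variable {α β ι V V' : Type*}

theorem symmDiff_singleton_of_mem {s : Set α} {a : α} (ha : a ∈ s) : s ∆ {a} = s \ {a} := by
  ext x; simp only [mem_symmDiff, mem_singleton_iff, mem_sdiff]; grind

theorem symmDiff_singleton_of_notMem {s : Set α} {a : α} (ha : a ∉ s) : s ∆ {a} = insert a s := by
  ext x; simp only [mem_symmDiff, mem_singleton_iff, mem_insert_iff]; grind

theorem hasse_set_adj_iff {s t : Set α} : (hasse (Set α)).Adj s t ↔ ∃ a, t = s ∆ {a} := by
  rw [hasse_adj, covBy_iff_exists_insert, covBy_iff_exists_sdiff_singleton]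
  constructor
  · rintro (⟨a, ha, rfl⟩ | ⟨a, ha, rfl⟩)
    · exact ⟨a, (symmDiff_singleton_of_notMem ha).symm⟩
    · exact ⟨a, (symmDiff_singleton_of_mem ha).symm⟩
  · rintro ⟨a, rfl⟩
    by_cases ha : a ∈ s
    · exact .inr ⟨a, ha, (symmDiff_singleton_of_mem ha).symm⟩
    · exact .inl ⟨a, ha, (symmDiff_singleton_of_notMem ha).symm⟩

/-- The embedding of cube graphs that sends `s` to the image of `s` under `d`, translated by `g`:
its range is the subcube through `g` in the directions `d i`. -/
def cubeEmbedding (g : Set β) (d : ι ↪ β) : hasse (Set ι) ↪g hasse (Set β) where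
  toFun s := g ∆ (d '' s)
  inj' := (symmDiff_right_injective g).comp d.injective.image_injective
  map_rel_iff' {s t} := by
    change (hasse (Set β)).Adj (g ∆ (d '' s)) (g ∆ (d '' t)) ↔ (hasse (Set ι)).Adj s t
    simp only [hasse_set_adj_iff, symmDiff_assoc, symmDiff_right_inj]
    constructor
    · rintro ⟨b, hb⟩
      have hb' : {b} = d '' (s ∆ t) := by
        rw [image_symmDiff d.injective, hb, symmDiff_symmDiff_cancel_left]
      obtain ⟨i, -, rfl⟩ : b ∈ d '' (s ∆ t) := hb' ▸ mem_singleton b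
      refine ⟨i, d.injective.image_injective ?_⟩
      rw [hb, image_symmDiff d.injective, image_singleton]
    · rintro ⟨i, rfl⟩
      exact ⟨d i, by rw [image_symmDiff d.injective, image_singleton]⟩

theorem cubeEmbedding_apply (g : Set β) (d : ι ↪ β) (s : Set ι) :
    cubeEmbedding g d s = g ∆ (d '' s) := rfl

theorem symmDiff_subset_iff_mem_Icc {g r x : Set α} : g ∆ x ⊆ r ↔ x ∈ Icc (g \ r) (g ∪ r) := by
  simp only [mem_Icc, subset_def, mem_symmDiff, mem_sdiff, mem_union, ← forall_and]
  grind

theorem range_cubeEmbedding (g : Set β) (d : ι ↪ β) :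
    range (cubeEmbedding g d) = Icc (g \ range d) (g ∪ range d) := by
  ext x
  rw [← symmDiff_subset_iff_mem_Icc, subset_range_iff_exists_image_eq]
  refine exists_congr fun s ↦ ?_
  rw [cubeEmbedding_apply, eq_comm, ← (symmDiff_right_involutive g).eq_iff]
  exact eq_comm

theorem eq_or_eq_of_adj_insert_of_adj_insert {r s : Set α} {a b : α} (ha : a ∉ r) (hb : b ∉ r)
    (hab : a ≠ b) (hsa : (hasse (Set α)).Adj (insert a r) s)
    (hsb : (hasse (Set α)).Adj (insert b r) s) : s = r ∨ s = insert a (insert b r) := by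
  obtain ⟨p, rfl⟩ := hasse_set_adj_iff.1 hsa
  obtain ⟨q, hq⟩ := hasse_set_adj_iff.1 hsb
  simp only [Set.ext_iff, mem_symmDiff, mem_insert_iff, mem_singleton_iff] at hq ⊢
  have hqa := hq a
  have hqb := hq b
  have hqp := hq p
  grind

theorem exists_apply_eq_image [Finite ι] (f : hasse (Set ι) ↪g hasse (Set β)) (hf : f ∅ = ∅) :
    ∃ d : ι ↪ β, ∀ s, f s = d '' s := by
  have exists_direction (i : ι) : ∃ b, f {i} = {b} := by
    have : (hasse (Set β)).Adj (f ∅) (f {i}) :=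
      f.map_adj_iff.2 (hasse_set_adj_iff.2 ⟨i, (bot_symmDiff {i}).symm⟩)
    rw [hf, hasse_set_adj_iff] at this
    exact this.imp fun b hb ↦ hb.trans (bot_symmDiff {b})
  choose d hd using exists_direction
  have hd_inj : Function.Injective d := fun i j hij ↦
    singleton_injective (f.injective (by rw [hd, hd, hij]))
  suffices h : ∀ s, f s = d '' s ∧ ∀ i ∉ s, f (insert i s) = insert (d i) (d '' s) from
    ⟨⟨d, hd_inj⟩, fun s ↦ (h s).1⟩
  intro s
  induction s, s.toFinite using Set.Finite.induction_on with
  | empty => simp [hf, hd]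
  | @insert j s hj _ ih =>
    obtain ⟨hs, hs_insert⟩ := ih
    refine ⟨by rw [hs_insert j hj, image_insert_eq], fun i hi ↦ ?_⟩
    obtain ⟨hij, his⟩ : i ≠ j ∧ i ∉ s := by simpa using hi
    have adj_insert {k l : ι} (hl : l ∉ insert k s) :
        (hasse (Set β)).Adj (f (insert k s)) (f (insert l (insert k s))) :=
      f.map_adj_iff.2 (hasse_set_adj_iff.2 ⟨l, (symmDiff_singleton_of_notMem hl).symm⟩)
    have hfi := adj_insert (k := i) (l := j) (by simp [hij.symm, hj])
    have hfj := adj_insert (k := j) (l := i) hi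
    rw [hs_insert i his, insert_comm] at hfi
    rw [hs_insert j hj] at hfj
    rw [image_insert_eq]
    refine (eq_or_eq_of_adj_insert_of_adj_insert ?_ ?_ (hd_inj.ne hij) hfi hfj).resolve_left ?_
    · simpa [hd_inj.eq_iff] using his
    · simpa [hd_inj.eq_iff] using hj
    · rw [← hs]
      exact f.injective.ne fun h ↦ his (h ▸ mem_insert i _)

theorem exists_eq_cubeEmbedding [Finite ι] (f : hasse (Set ι) ↪g hasse (Set β)) :
    ∃ g d, f = cubeEmbedding g d := by
  obtain ⟨d, hd⟩ := exists_apply_eq_image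
    ((cubeEmbedding (f ∅) (.refl β)).comp f) (by simp [cubeEmbedding_apply])
  refine ⟨f ∅, d, DFunLike.ext _ _ fun s ↦ ?_⟩
  rw [cubeEmbedding_apply, ← hd]
  simp [cubeEmbedding_apply]

open Classical in
/-- Binary strings of length `k` as subsets of `Fin k`. -/
noncomputable def hypercubeIso (k : ℕ) : hypercube k ≃g hasse (Set (Fin k)) where
  toFun u := {i | u i = true}
  invFun s i := decide (i ∈ s)
  left_inv u := by ext; simp
  right_inv s := by ext; simp
  map_rel_iff' {u v} := by
    change (hasse (Set (Fin k))).Adj {i | u i = true} {i | v i = true} ↔ hammingDist u v = 1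
    rw [hasse_set_adj_iff, hammingDist, Finset.card_eq_one]
    refine exists_congr fun a ↦ ?_
    simp only [Set.ext_iff, Finset.ext_iff, mem_symmDiff, mem_ofPred_eq, mem_singleton_iff,
      Finset.mem_filter_univ, Finset.mem_singleton]
    refine forall_congr' fun i ↦ ?_
    cases u i <;> cases v i <;> by_cases h : i = a <;> simp [h]

theorem nonempty_induce_iso_iff {G : SimpleGraph V} {H : SimpleGraph V'} {W : Set V} :
    Nonempty (G.induce W ≃g H) ↔ ∃ f : H ↪g G, range f = W := by
  constructor
  · rintro ⟨f⟩
    refine ⟨(Embedding.induce W).comp f.symm.toEmbedding, ?_⟩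
    exact (f.symm.surjective.range_comp Subtype.val).trans Subtype.range_coe
  · rintro ⟨f, rfl⟩
    exact ⟨f.isoInduceRange.symm⟩

theorem nonempty_induce_image_iso_iff {G : SimpleGraph V} {G' : SimpleGraph V'} {H : SimpleGraph ι}
    (φ : G ↪g G') {W : Set V} :
    Nonempty (G'.induce (φ '' W) ≃g H) ↔ Nonempty (G.induce W ≃g H) := by
  obtain ⟨e⟩ : Nonempty (G'.induce (φ '' W) ≃g G.induce W) :=
    nonempty_induce_iso_iff.2 ⟨φ.comp (.induce W), by
      rw [RelEmbedding.coe_trans, range_comp]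
      exact congrArg (φ '' ·) Subtype.range_coe⟩
  exact ⟨fun ⟨f⟩ ↦ ⟨f.comp e.symm⟩, fun ⟨f⟩ ↦ ⟨f.comp e⟩⟩

theorem nonempty_induce_hasse_set_iso_hypercube_iff {W : Set (Set α)} {k : ℕ} :
    Nonempty ((hasse (Set α)).induce W ≃g hypercube k) ↔
      ∃ s t, t ⊆ s ∧ t.encard = (k : ℕ∞) ∧ W = Icc (s \ t) s := by
  constructor
  · rintro ⟨f⟩
    obtain ⟨ψ, rfl⟩ := nonempty_induce_iso_iff.1 ⟨(hypercubeIso k).comp f⟩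
    obtain ⟨g, d, rfl⟩ := exists_eq_cubeEmbedding ψ
    refine ⟨g ∪ range d, range d, subset_union_right, ?_, ?_⟩
    · rw [← image_univ, d.injective.encard_image, encard_univ, ENat.card_eq_coe_fintype_card,
        Fintype.card_fin]
    · rw [union_sdiff_right, range_cubeEmbedding]
  · rintro ⟨s, t, hts, hk, rfl⟩
    have : Finite t := finite_of_encard_eq_coe hk
    let e : Fin k ≃ t := (Finite.equivFinOfCardEq (by simp [ncard_def, hk])).symm
    let d : Fin k ↪ α := e.toEmbedding.trans (.subtype _)
    have hd : range d = t := (e.surjective.range_comp Subtype.val).trans Subtype.range_coe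
    obtain ⟨f⟩ := nonempty_induce_iso_iff.2 ⟨cubeEmbedding s d, rfl⟩
    rw [range_cubeEmbedding, hd] at f
    rw [union_eq_self_of_subset_right hts] at f
    exact ⟨(hypercubeIso k).symm.comp f⟩

theorem nonempty_induce_iso_hypercube_iff {G : SimpleGraph V} (φ : G ↪g hasse (Set α))
    {W : Set V} {k : ℕ} :
    Nonempty (G.induce W ≃g hypercube k) ↔
      ∃ s t, t ⊆ s ∧ t.encard = (k : ℕ∞) ∧ φ '' W = Icc (s \ t) s := by
  rw [← nonempty_induce_image_iso_iff φ, nonempty_induce_hasse_set_iso_hypercube_iff]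

end CubeGraph

section CubeCount

open SimpleGraph Set
open scoped symmDiff

variable {α V V' : Type*} {G : SimpleGraph V}

theorem inducedCubeCount_congr {G' : SimpleGraph V'} (f : G ≃g G') (k : ℕ) :
    inducedCubeCount G k = inducedCubeCount G' k := by
  refine ncard_congr (fun W _ ↦ f '' W) (fun W hW ↦ ?_)
    (fun W W' _ _ h ↦ f.injective.image_injective h) (fun W hW ↦ ⟨f ⁻¹' W, ?_, ?_⟩)
  · exact (nonempty_induce_image_iso_iff f.toEmbedding).2 hW
  · refine (nonempty_induce_image_iso_iff f.toEmbedding).1 ?_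
    rwa [RelIso.coe_toRelEmbedding, image_preimage_eq W f.surjective]
  · exact image_preimage_eq W f.surjective

theorem inducedCubeCount_eq_finsum [Finite α] (φ : G ↪g hasse (Set α)) (D : V → Set α)
    (hD : ∀ v t, t ⊆ D v ↔ t ⊆ φ v ∧ Icc (φ v \ t) (φ v) ⊆ range φ) (k : ℕ) :
    inducedCubeCount G k = ∑ᶠ v, (D v).ncard.choose k := by
  have : Finite V := .of_injective φ φ.injective
  have := Fintype.ofFinite V
  let cube (p : Σ v, {t : Set α | t ⊆ D v ∧ t.ncard = k}) : Set V :=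
    φ ⁻¹' Icc (φ p.1 \ p.2) (φ p.1)
  have image_cube p : φ '' cube p = Icc (φ p.1 \ p.2) (φ p.1) :=
    image_preimage_eq_of_subset ((hD _ _).1 p.2.2.1).2
  have cube_injective : Function.Injective cube := by
    rintro ⟨v, t, ht, htk⟩ ⟨v', t', ht', htk'⟩ h
    have hIcc := congrArg (φ '' ·) h
    simp only [image_cube] at hIcc
    rw [Icc_eq_Icc_iff sdiff_subset] at hIcc
    obtain rfl := φ.injective hIcc.2
    obtain rfl : t = t' := by
      rw [← sdiff_sdiff_cancel_left ((hD _ _).1 ht).1, hIcc.1,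
        sdiff_sdiff_cancel_left ((hD _ _).1 ht').1]
    rfl
  have range_cube : range cube = {W | Nonempty (G.induce W ≃g hypercube k)} := by
    ext W
    rw [mem_ofPred_eq, nonempty_induce_iso_hypercube_iff φ]
    constructor
    · rintro ⟨⟨v, t, ht, htk⟩, rfl⟩
      refine ⟨φ v, t, ((hD _ _).1 ht).1, ?_, image_cube _⟩
      rw [← htk, t.toFinite.cast_ncard_eq]
    · rintro ⟨s, t, hts, htk, hW⟩
      obtain ⟨v, -, rfl⟩ : s ∈ φ '' W := hW ▸ right_mem_Icc.2 sdiff_subset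
      refine ⟨⟨v, t, (hD _ _).2 ⟨hts, hW ▸ image_subset_range _ _⟩, by simp [ncard_def, htk]⟩, ?_⟩
      exact φ.injective.image_injective ((image_cube _).trans hW.symm)
  calc inducedCubeCount G k
      = Nat.card (Σ v, {t : Set α | t ⊆ D v ∧ t.ncard = k}) := by
        rw [inducedCubeCount, ← range_cube, ← image_univ, ncard_image_of_injective _ cube_injective,
          ncard_univ]
    _ = ∑ᶠ v, (D v).ncard.choose k := by
        rw [Nat.card_sigma, finsum_eq_sum_of_fintype]
        exact Finset.sum_congr rfl fun v _ ↦ ncard_powerset_ncard (D v).toFinite k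

end CubeCount

section WellGraded

open SimpleGraph Set
open scoped symmDiff

variable {α L M V : Type*}

/-- A well-graded family: from any member one can reach any other one inside the family by changing
one element at a time, each change reducing the symmetric difference. -/
def IsWellGraded (𝓕 : Set (Set α)) : Prop :=
  ∀ s ∈ 𝓕, ∀ t ∈ 𝓕, s ≠ t → ∃ a ∈ s ∆ t, s ∆ {a} ∈ 𝓕

theorem isWellGraded_of_isLowerSet {𝓕 : Set (Set α)} (h𝓕 : IsLowerSet 𝓕) : IsWellGraded 𝓕 := by
  intro s hs t ht hst
  by_cases h : s ⊆ t
  · obtain ⟨a, hat, has⟩ := not_subset.1 fun h' ↦ hst (h.antisymm h')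
    refine ⟨a, .inr ⟨hat, has⟩, ?_⟩
    rw [symmDiff_singleton_of_notMem has]
    exact h𝓕 (insert_subset hat h) ht
  · obtain ⟨a, has, hat⟩ := not_subset.1 h
    refine ⟨a, .inl ⟨has, hat⟩, ?_⟩
    rw [symmDiff_singleton_of_mem has]
    exact h𝓕 sdiff_subset hs

theorem isWellGraded_setOf_isLowerSet [Finite α] [PartialOrder α] :
    IsWellGraded {s : Set α | IsLowerSet s} := by
  intro s hs t ht hst
  by_cases h : s ⊆ t
  · have hts : (t \ s).Nonempty := nonempty_of_not_subset fun h' ↦ hst (h.antisymm h')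
    obtain ⟨a, ⟨hat, has⟩, ha_min⟩ := (t \ s).toFinite.exists_minimal hts
    refine ⟨a, .inr ⟨hat, has⟩, ?_⟩
    rw [symmDiff_singleton_of_notMem has]
    rintro b c hcb (rfl | hbs)
    · by_contra hc
      obtain ⟨hcb', hcs⟩ := not_or.1 hc
      exact hcb' (hcb.antisymm (ha_min ⟨ht hcb hat, hcs⟩ hcb))
    · exact .inr (hs hcb hbs)
  · obtain ⟨a, ⟨has, hat⟩, ha_max⟩ := (s \ t).toFinite.exists_maximal (nonempty_of_not_subset h)
    refine ⟨a, .inl ⟨has, hat⟩, ?_⟩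
    rw [symmDiff_singleton_of_mem has]
    rintro b c hcb ⟨hbs, hba⟩
    refine ⟨hs hcb hbs, ?_⟩
    rintro rfl
    exact hba ((ha_max ⟨hbs, fun hbt ↦ hat (ht hcb hbt)⟩ hcb).antisymm hcb)

theorem map_covBy_of_isWellGraded [PartialOrder L] (φ : L ↪o Set α) (h : IsWellGraded (range φ))
    {x y : L} (hxy : x ⋖ y) : φ x ⋖ φ y := by
  obtain ⟨a, ha, z, hz⟩ :=
    h _ (mem_range_self x) _ (mem_range_self y) (φ.injective.ne hxy.ne)
  have hφ : φ x ⊆ φ y := φ.monotone hxy.le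
  obtain ⟨hay, hax⟩ : a ∈ φ y ∧ a ∉ φ x := ha.resolve_left fun h ↦ h.2 (hφ h.1)
  rw [symmDiff_singleton_of_notMem hax] at hz
  have hxz : x < z := φ.lt_iff_lt.1 (hz ▸ ssubset_insert hax)
  have hzy : z ≤ y := φ.le_iff_le.1 (hz ▸ insert_subset hay hφ)
  obtain rfl := (hxy.eq_or_eq hxz.le hzy).resolve_left hxz.ne'
  rw [hz]
  exact covBy_insert hax

/-- The isomorphism of Hasse diagrams induced by an order isomorphism. -/
def hasseIso [PartialOrder L] [PartialOrder M] (o : L ≃o M) : hasse L ≃g hasse M where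
  toEquiv := o.toEquiv
  map_rel_iff' := or_congr (apply_covBy_apply_iff o) (apply_covBy_apply_iff o)

/-- The Hasse diagram of a partial order represented by a well-graded family of sets, as an induced
subgraph of the cube graph. -/
def hasseEmbedding [PartialOrder L] (φ : L ↪o Set α) (h : IsWellGraded (range φ)) :
    hasse L ↪g hasse (Set α) where
  toEmbedding := φ.toEmbedding
  map_rel_iff' := or_congr
    ⟨CovBy.of_image φ, map_covBy_of_isWellGraded φ h⟩
    ⟨CovBy.of_image φ, map_covBy_of_isWellGraded φ h⟩

variable {G : SimpleGraph V}

theorem ncard_symmDiff_le_length [Finite α] (φ : G ↪g hasse (Set α)) {v w : V} (p : G.Walk v w) :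
    (φ v ∆ φ w).ncard ≤ p.length := by
  induction p with
  | nil => simp
  | @cons u v w h p ih =>
    obtain ⟨a, ha⟩ := hasse_set_adj_iff.1 (φ.map_adj_iff.2 h)
    calc (φ u ∆ φ w).ncard
        ≤ (φ u ∆ φ v ∪ φ v ∆ φ w).ncard := ncard_le_ncard (symmDiff_triangle _ _ _)
      _ ≤ (φ u ∆ φ v).ncard + (φ v ∆ φ w).ncard := ncard_union_le _ _
      _ ≤ p.length + 1 := by
        rw [ha, symmDiff_symmDiff_cancel_left, ncard_singleton, ← ha]
        omega

theorem exists_walk_length_eq_ncard_symmDiff [Finite α] (φ : G ↪g hasse (Set α))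
    (hφ : IsWellGraded (range φ)) (v w : V) :
    ∃ p : G.Walk v w, p.length = (φ v ∆ φ w).ncard := by
  by_cases hvw : v = w
  · subst hvw
    exact ⟨.nil, by simp⟩
  obtain ⟨a, ha, u, hu⟩ :=
    hφ _ (mem_range_self v) _ (mem_range_self w) (φ.injective.ne hvw)
  have hcard : (φ u ∆ φ w).ncard + 1 = (φ v ∆ φ w).ncard := by
    rw [← ncard_sdiff_singleton_add_one ha, ← symmDiff_singleton_of_mem ha, hu,
      symmDiff_right_comm]
  obtain ⟨p, hp⟩ := exists_walk_length_eq_ncard_symmDiff φ hφ u w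
  have hadj : G.Adj v u := φ.map_adj_iff.1 (hasse_set_adj_iff.2 ⟨a, hu⟩)
  exact ⟨.cons hadj p, by rw [Walk.length_cons, hp, hcard]⟩
termination_by (φ v ∆ φ w).ncard
decreasing_by omega

theorem dist_eq_ncard_symmDiff [Finite α] (φ : G ↪g hasse (Set α)) (hφ : IsWellGraded (range φ))
    (v w : V) : G.dist v w = (φ v ∆ φ w).ncard := by
  obtain ⟨p, hp⟩ := exists_walk_length_eq_ncard_symmDiff φ hφ v w
  obtain ⟨q, hq⟩ := p.reachable.exists_walk_length_eq_dist
  exact le_antisymm (hp ▸ dist_le p) (hq ▸ ncard_symmDiff_le_length φ q)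

theorem ncard_symmDiff_eq_add_iff [Finite α] {s t : Set α} :
    (s ∆ t).ncard = s.ncard + t.ncard ↔ Disjoint s t := by
  have hinter := ncard_union_add_ncard_inter s t
  have hsdiff : (s ∆ t).ncard + (s ∩ t).ncard = (s ∪ t).ncard := by
    rw [symmDiff_eq_sup_sdiff_inf]
    exact ncard_sdiff_add_ncard_of_subset (inter_subset_left.trans subset_union_left)
  rw [disjoint_iff_inter_eq_empty, ← ncard_eq_zero]
  omega

theorem disjoint_symmDiff_symmDiff_iff {s t x : Set α} :
    Disjoint (s ∆ x) (x ∆ t) ↔ x ∈ Icc (s ∩ t) (s ∪ t) := by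
  simp only [Set.disjoint_left, mem_Icc, subset_def, mem_symmDiff, mem_inter_iff, mem_union,
    ← forall_and]
  grind

theorem dist_eq_dist_add_dist_iff [Finite α] (φ : G ↪g hasse (Set α))
    (hφ : IsWellGraded (range φ)) {u v w : V} :
    G.dist v w = G.dist v u + G.dist u w ↔ φ u ∈ Icc (φ v ∩ φ w) (φ v ∪ φ w) := by
  simp only [dist_eq_ncard_symmDiff φ hφ]
  rw [← disjoint_symmDiff_symmDiff_iff, ← ncard_symmDiff_eq_add_iff, symmDiff_assoc,
    symmDiff_symmDiff_cancel_left]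

end WellGraded

section LowerSets

open SimpleGraph Set

variable {P : Type*} [PartialOrder P]

theorem range_coe_lowerSet (α : Type*) [LE α] :
    range ((↑) : LowerSet α → Set α) = {s | IsLowerSet s} :=
  Subset.antisymm (range_subset_iff.2 fun s ↦ s.lower) fun s hs ↦ ⟨⟨s, hs⟩, rfl⟩

theorem isWellGraded_range_coe_lowerSet [Finite P] :
    IsWellGraded (range ((↑) : LowerSet P → Set P)) :=
  range_coe_lowerSet P ▸ isWellGraded_setOf_isLowerSet

/-- The Hasse diagram of the lower sets of a finite poset, as an induced subgraph of the cube
graph. -/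
def lowerSetEmbedding (P : Type*) [PartialOrder P] [Finite P] :
    hasse (LowerSet P) ↪g hasse (Set P) :=
  hasseEmbedding (.ofMapLEIff (↑) fun _ _ ↦ .rfl)
    isWellGraded_range_coe_lowerSet

theorem lowerSetEmbedding_apply [Finite P] (I : LowerSet P) : lowerSetEmbedding P I = I := rfl

theorem range_lowerSetEmbedding [Finite P] :
    range (lowerSetEmbedding P) = {s | IsLowerSet s} :=
  range_coe_lowerSet P

theorem dist_bot_top_eq_dist_add_dist [Finite P] (I : LowerSet P) :
    (hasse (LowerSet P)).dist ⊥ ⊤ =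
      (hasse (LowerSet P)).dist ⊥ I + (hasse (LowerSet P)).dist I ⊤ := by
  rw [dist_eq_dist_add_dist_iff (lowerSetEmbedding P) isWellGraded_range_coe_lowerSet]
  simp [lowerSetEmbedding_apply]

theorem subset_setOf_maximal_iff {s t : Set P} (hs : IsLowerSet s) :
    t ⊆ {a | Maximal (· ∈ s) a} ↔ t ⊆ s ∧ Icc (s \ t) s ⊆ {s | IsLowerSet s} := by
  constructor
  · refine fun ht ↦ ⟨fun a ha ↦ (ht ha).1, fun x ⟨hx, hxs⟩ b a hab hb ↦ ?_⟩
    by_cases hat : a ∈ t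
    · rwa [(ht hat).eq_of_le (hxs hb) hab]
    · exact hx ⟨hs hab (hxs hb), hat⟩
  · rintro ⟨hts, hlower⟩ a ha
    refine ⟨hts ha, fun b hb hab ↦ ?_⟩
    by_contra hba
    have : IsLowerSet (s \ {a}) :=
      hlower ⟨sdiff_subset_sdiff_right (singleton_subset_iff.2 ha), sdiff_subset⟩
    exact (this hab ⟨hb, fun h ↦ hba h.le⟩).2 rfl

/-- Lower sets of a finite poset correspond to antichains through their maximal elements. -/
def lowerSetEquivAntichain (P : Type*) [PartialOrder P] [Finite P] :
    LowerSet P ≃ {s : Set P // IsAntichain (· ≤ ·) s} where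
  toFun I := ⟨{a | Maximal (· ∈ I) a}, setOfPred_maximal_antichain _⟩
  invFun s := lowerClosure s.1
  left_inv I := by
    ext a
    rw [SetLike.mem_coe, mem_lowerClosure]
    constructor
    · rintro ⟨b, hb, hab⟩
      exact I.lower hab hb.1
    · intro ha
      obtain ⟨b, hab, hb⟩ := (toFinite (I : Set P)).exists_le_maximal ha
      exact ⟨b, hb, hab⟩
  right_inv s := Subtype.ext <| ext fun _ ↦ s.2.maximal_mem_lowerClosure_iff_mem

/-- The comparability graph of a partial order. -/
def comparabilityGraph (P : Type*) [PartialOrder P] : SimpleGraph P where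
  Adj a b := a < b ∨ b < a
  symm := ⟨fun _ _ ↦ Or.symm⟩
  loopless := ⟨fun _ h ↦ h.elim (lt_irrefl _) (lt_irrefl _)⟩

theorem isIndepSet_comparabilityGraph_iff {s : Set P} :
    (comparabilityGraph P).IsIndepSet s ↔ IsAntichain (· ≤ ·) s := by
  refine ⟨fun h a ha b hb hab hle ↦ h ha hb hab (.inl (hle.lt_of_ne hab)), ?_⟩
  exact fun h a ha b hb hab ↦
    not_or.2 ⟨fun hlt ↦ h ha hb hab hlt.le, fun hlt ↦ h hb ha hab.symm hlt.le⟩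

end LowerSets

section IndepGraph

open SimpleGraph Set
open scoped symmDiff

variable {V V' : Type*} {H : SimpleGraph V} {H' : SimpleGraph V'}

/-- The graph of independent sets of `H`, two of which are adjacent when they differ in exactly one
vertex. -/
def indepGraph (H : SimpleGraph V) : SimpleGraph {s : Set V // H.IsIndepSet s} :=
  (hasse (Set V)).induce {s | H.IsIndepSet s}

/-- The independent sets of `H`, as an induced subgraph of the cube graph. -/
def indepEmbedding (H : SimpleGraph V) : indepGraph H ↪g hasse (Set V) :=
  Embedding.induce _

theorem indepEmbedding_apply (s : {s : Set V // H.IsIndepSet s}) : indepEmbedding H s = s := rfl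

theorem range_indepEmbedding : range (indepEmbedding H) = {s | H.IsIndepSet s} :=
  Subtype.range_coe

theorem nonempty_iso_indepGraph_iff {G : SimpleGraph V'} :
    Nonempty (G ≃g indepGraph H) ↔
      ∃ φ : G ↪g hasse (Set V), range φ = {s | H.IsIndepSet s} := by
  rw [← nonempty_induce_iso_iff]
  exact ⟨fun ⟨f⟩ ↦ ⟨f.symm⟩, fun ⟨f⟩ ↦ ⟨f.symm⟩⟩

theorem isLowerSet_setOf_isIndepSet : IsLowerSet {s | H.IsIndepSet s} :=
  fun _ _ hts hs ↦ hs.mono hts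

theorem inducedCubeCount_indepGraph [Finite V] (H : SimpleGraph V) (k : ℕ) :
    inducedCubeCount (indepGraph H) k =
      ∑ᶠ s : {s : Set V // H.IsIndepSet s}, s.1.ncard.choose k := by
  refine inducedCubeCount_eq_finsum (indepEmbedding H) (↑) (fun s t ↦ ?_) k
  rw [range_indepEmbedding, indepEmbedding_apply, iff_self_and]
  exact fun _ x hx ↦ s.2.mono hx.2

theorem inducedCubeCount_indepGraph_congr [Finite V] [Finite V']
    (e : {s : Set V // H.IsIndepSet s} ≃ {s : Set V' // H'.IsIndepSet s})
    (he : ∀ s, (e s).1.ncard = s.1.ncard) (k : ℕ) :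
    inducedCubeCount (indepGraph H) k = inducedCubeCount (indepGraph H') k := by
  rw [inducedCubeCount_indepGraph, inducedCubeCount_indepGraph, ← finsum_comp_equiv e]
  simp only [he]

theorem isIndepSet_image_iff (f : V ↪ V') {s : Set V}
    (h : ∀ a ∈ s, ∀ b ∈ s, H'.Adj (f a) (f b) ↔ H.Adj a b) :
    H'.IsIndepSet (f '' s) ↔ H.IsIndepSet s := by
  rw [isIndepSet_iff, isIndepSet_iff, f.injective.injOn.pairwise_image]
  exact forall₂_congr fun a ha ↦ forall₂_congr fun b hb ↦ imp_congr_right fun _ ↦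
    not_congr (h a ha b hb)

theorem inducedCubeCount_indepGraph_of_iso [Finite V] [Finite V']
    (f : H ≃g H') (k : ℕ) :
    inducedCubeCount (indepGraph H) k = inducedCubeCount (indepGraph H') k :=
  inducedCubeCount_indepGraph_congr
    ((Equiv.Set.congr f.toEquiv).subtypeEquiv fun _ ↦
      (isIndepSet_image_iff f.toEquiv.toEmbedding fun _ _ _ _ ↦ f.map_adj_iff).symm)
    (fun s ↦ ncard_image_of_injective s.1 f.injective) k

theorem inducedCubeCount_hasse_lowerSet (P : Type*) [PartialOrder P] [Finite P] (k : ℕ) :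
    inducedCubeCount (hasse (LowerSet P)) k =
      inducedCubeCount (indepGraph (comparabilityGraph P)) k := by
  let e : LowerSet P ≃ {s // (comparabilityGraph P).IsIndepSet s} :=
    (lowerSetEquivAntichain P).trans
      (Equiv.subtypeEquivRight fun _ ↦ isIndepSet_comparabilityGraph_iff.symm)
  rw [inducedCubeCount_indepGraph, ← finsum_comp_equiv e]
  refine inducedCubeCount_eq_finsum (lowerSetEmbedding P) (fun I ↦ e I) (fun I t ↦ ?_) k
  rw [range_lowerSetEmbedding, lowerSetEmbedding_apply]
  exact subset_setOf_maximal_iff I.lower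

end IndepGraph

section Bipartite

open SimpleGraph Set
open scoped symmDiff

universe u

variable {L : Type*} {V : Type u} {H : SimpleGraph V}

/-- The partial order of height at most two whose strict relations are the edges of `H` leading
from `K` to its complement. -/
@[reducible] def bipartiteOrder (H : SimpleGraph V) (K : Set V) : PartialOrder V where
  le a b := a = b ∨ a ∈ K ∧ b ∉ K ∧ H.Adj a b
  le_refl _ := .inl rfl
  le_trans a b c := by grind
  le_antisymm a b := by grind

theorem isLowerSet_symmDiff_iff_isIndepSet {K s : Set V}
    (hK : ∀ a b, H.Adj a b → (a ∈ K ↔ b ∉ K)) :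
    @IsLowerSet V (bipartiteOrder H K).toLE (K ∆ s) ↔ H.IsIndepSet s := by
  simp only [IsLowerSet, IsIndepSet, Set.Pairwise, mem_symmDiff, LE.le]
  constructor
  · intro h a ha b hb _ hab
    by_cases haK : a ∈ K
    · have := h (a := b) (b := a)
      grind
    · have := h (a := a) (b := b)
      grind [hab.symm]
  · rintro h b a (rfl | ⟨haK, hbK, hab⟩) hb
    · exact hb
    · have := h (x := a) (y := b)
      grind [hab.ne]

theorem exists_distribLattice_iso_indepGraph [Finite V] (hH : H.IsBipartite) :
    ∃ (L : Type u) (_ : DistribLattice L), Finite L ∧ Nonempty (hasse L ≃g indepGraph H) := by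
  obtain ⟨K, K', hKK'⟩ := hH.exists_isBipartiteWith
  have hK a b (hab : H.Adj a b) : a ∈ K ↔ b ∉ K := by
    have := hKK'.mem_of_adj hab
    have := Set.disjoint_left.1 hKK'.disjoint
    grind
  let := bipartiteOrder H K
  refine ⟨LowerSet V, inferInstance, inferInstance, nonempty_iso_indepGraph_iff.2
    ⟨(cubeEmbedding K (.refl V)).comp (lowerSetEmbedding V), ?_⟩⟩
  have hcube : ⇑(cubeEmbedding K (.refl V)) = (K ∆ ·) :=
    funext fun s ↦ congrArg (K ∆ ·) (image_id s)
  rw [RelEmbedding.coe_trans, range_comp, range_lowerSetEmbedding, hcube,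
    image_eq_preimage_of_inverse (symmDiff_symmDiff_cancel_left K)
      (symmDiff_symmDiff_cancel_left K)]
  exact ext fun s ↦ isLowerSet_symmDiff_iff_isIndepSet hK

theorem isBipartite_of_hasse_iso_indepGraph [Finite V] [DistribLattice L]
    (f : hasse L ≃g indepGraph H) : H.IsBipartite := by
  classical
  have : Finite L := .of_equiv _ f.symm.toEquiv
  have := Fintype.ofFinite L
  have : Nonempty L := ⟨f.symm ⟨∅, by simp⟩⟩
  let := Fintype.toBoundedOrder L
  let g : hasse (LowerSet {a : L // SupIrred a}) ≃g indepGraph H :=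
    f.comp (hasseIso OrderIso.lowerSetSupIrred.symm)
  obtain ⟨φ, hφ⟩ := nonempty_iso_indepGraph_iff.1 ⟨g⟩
  have mem_Icc {s : Set V} (hs : H.IsIndepSet s) : s ∈ Icc (φ ⊥ ∩ φ ⊤) (φ ⊥ ∪ φ ⊤) := by
    obtain ⟨I, rfl⟩ : s ∈ range φ := hφ ▸ hs
    have hφ_graded : IsWellGraded (range φ) :=
      hφ ▸ isWellGraded_of_isLowerSet isLowerSet_setOf_isIndepSet
    exact (dist_eq_dist_add_dist_iff φ hφ_graded).1 (dist_bot_top_eq_dist_add_dist I)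
  have hbot : H.IsIndepSet (φ ⊥) := hφ.subset (mem_range_self _)
  have htop : H.IsIndepSet (φ ⊤) := hφ.subset (mem_range_self _)
  have hdisj : Disjoint (φ ⊥) (φ ⊤) :=
    disjoint_iff_inter_eq_empty.2 (subset_empty_iff.1 (mem_Icc (s := ∅) (by simp)).1)
  have hcover v : v ∈ φ ⊥ ∪ φ ⊤ := (mem_Icc (s := {v}) (by simp)).2 rfl
  refine IsBipartiteWith.isBipartite ⟨hdisj, fun v w hvw ↦ ?_⟩
  obtain hv | hv := hcover v <;> obtain hw | hw := hcover w
  · exact (hbot hv hw hvw.ne hvw).elim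
  · exact .inl ⟨hv, hw⟩
  · exact .inr ⟨hv, hw⟩
  · exact (htop hv hw hvw.ne hvw).elim

end Bipartite

section LucasCube

open SimpleGraph Set

variable {n : ℕ}

theorem val_eq_add_one_mod_iff (hn : 2 ≤ n) {i j : Fin n} :
    (j : ℕ) = (i + 1) % n ↔ (j - i).val = 1 := by
  have : NeZero n := ⟨by omega⟩
  have val_one : ((1 : Fin n) : ℕ) = 1 := (Fin.val_one' n).trans (Nat.mod_eq_of_lt hn)
  rw [← val_one, ← Fin.val_add, ← Fin.ext_iff, ← Fin.ext_iff, sub_eq_iff_eq_add']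

theorem isLucasString_iff_isIndepSet (hn : 2 ≤ n) {u : Fin n → Bool} :
    IsLucasString u ↔ (cycleGraph n).IsIndepSet {i | u i = true} := by
  simp only [IsLucasString, val_eq_add_one_mod_iff hn, IsIndepSet, Set.Pairwise, cycleGraph_adj',
    mem_ofPred_eq]
  constructor
  · intro h i hi j hj _ hij
    exact hij.elim (fun hij ↦ h j i hij ⟨hj, hi⟩) (fun hij ↦ h i j hij ⟨hi, hj⟩)
  · rintro h i j hij ⟨hi, hj⟩
    refine h hi hj ?_ (.inr hij)
    rintro rfl
    have : NeZero n := ⟨by omega⟩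
    simp at hij

theorem nonempty_lucasCube_iso_indepGraph (hn : 2 ≤ n) :
    Nonempty (lucasCube n ≃g indepGraph (cycleGraph n)) := by
  let incl : lucasCube n ↪g hypercube n := .induce _
  have range_incl : range incl = {u | IsLucasString u} := Subtype.range_coe
  refine nonempty_iso_indepGraph_iff.2 ⟨(hypercubeIso n).toEmbedding.comp incl, ?_⟩
  rw [RelEmbedding.coe_trans, range_comp, range_incl]
  ext s
  obtain ⟨u, rfl⟩ := (hypercubeIso n).surjective s
  rw [RelIso.coe_toRelEmbedding, (hypercubeIso n).injective.mem_set_image]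
  exact isLucasString_iff_isIndepSet hn

theorem isBipartite_cycleGraph_iff (hn : 2 ≤ n) : (cycleGraph n).IsBipartite ↔ Even n := by
  refine ⟨fun h ↦ ?_, fun h ↦ (cycleGraph.bicoloring_of_even n h).colorable⟩
  rw [← Nat.not_odd_iff_even]
  intro hodd
  have : (3 : ℕ∞) ≤ 2 := chromaticNumber_cycleGraph_of_odd n hn hodd ▸ h.chromaticNumber_le
  exact absurd this (by decide)

end LucasCube

section Tadpole

open SimpleGraph Set

variable {V : Type*} {n : ℕ}

open Classical in
/-- The permutation of the subsets of `V` that applies `ρ` to those that contain the fixed point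
`v` of `ρ`, and leaves the others unchanged. -/
noncomputable def permSetsThrough {v : V} (ρ : Equiv.Perm V) (hv : ρ v = v) :
    Equiv.Perm (Set V) where
  toFun s := if v ∈ s then ρ '' s else s
  invFun s := if v ∈ s then ρ ⁻¹' s else s
  left_inv s := by
    by_cases h : v ∈ s
    · dsimp only
      rw [if_pos h, if_pos ⟨v, h, hv⟩, ρ.injective.preimage_image]
    · simp [h]
  right_inv s := by
    by_cases h : v ∈ s
    · simp [h, hv, ρ.surjective.image_preimage]
    · simp [h]

theorem permSetsThrough_of_mem {v : V} (ρ : Equiv.Perm V) (hv : ρ v = v) {s : Set V} (h : v ∈ s) :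
    permSetsThrough ρ hv s = ρ '' s := if_pos h

theorem permSetsThrough_of_notMem {v : V} (ρ : Equiv.Perm V) (hv : ρ v = v) {s : Set V}
    (h : v ∉ s) : permSetsThrough ρ hv s = s := if_neg h

theorem ncard_permSetsThrough {v : V} (ρ : Equiv.Perm V) (hv : ρ v = v) (s : Set V) :
    (permSetsThrough ρ hv s).ncard = s.ncard := by
  by_cases h : v ∈ s
  · rw [permSetsThrough_of_mem ρ hv h, ncard_image_of_injective s ρ.injective]
  · rw [permSetsThrough_of_notMem ρ hv h]

theorem isIndepSet_permSetsThrough_iff {H H' : SimpleGraph V} {v w : V} {ρ : Equiv.Perm V}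
    (hv : ρ v = v) (hH : H.Adj v w) (hH' : H'.Adj v (ρ w))
    (h_ne_v : ∀ a b, a ≠ v → b ≠ v → (H'.Adj a b ↔ H.Adj a b))
    (h_ne_w : ∀ a b, a ≠ w → b ≠ w → (H'.Adj (ρ a) (ρ b) ↔ H.Adj a b)) {s : Set V} :
    H'.IsIndepSet (permSetsThrough ρ hv s) ↔ H.IsIndepSet s := by
  by_cases hvs : v ∈ s
  · rw [permSetsThrough_of_mem ρ hv hvs]
    by_cases hws : w ∈ s
    · exact iff_of_false (fun h ↦ h ⟨v, hvs, hv⟩ ⟨w, hws, rfl⟩ hH'.ne hH')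
        (fun h ↦ h hvs hws hH.ne hH)
    · exact isIndepSet_image_iff ρ.toEmbedding fun a ha b hb ↦
        h_ne_w a b (ne_of_mem_of_not_mem ha hws) (ne_of_mem_of_not_mem hb hws)
  · rw [permSetsThrough_of_notMem ρ hv hvs]
    simpa using isIndepSet_image_iff (.refl V) fun a ha b hb ↦
      h_ne_v a b (ne_of_mem_of_not_mem ha hvs) (ne_of_mem_of_not_mem hb hvs)

/-- The tadpole graph: the path `0, 1, …, n - 1` together with the edge joining `0` and `2`. -/
def tadpoleGraph (n : ℕ) : SimpleGraph (Fin n) :=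
  .fromRel fun i j ↦ (i : ℕ) + 1 = j ∨ (i : ℕ) = 0 ∧ (j : ℕ) = 2

theorem cycleGraph_adj_iff_val (hn : 2 ≤ n) {i j : Fin n} :
    (cycleGraph n).Adj i j ↔ (i : ℕ) + 1 = j ∨ (j : ℕ) + 1 = i ∨
      (i : ℕ) = 0 ∧ (j : ℕ) + 1 = n ∨ (j : ℕ) = 0 ∧ (i : ℕ) + 1 = n := by
  have mod_eq (k : Fin n) : ((k : ℕ) + 1) % n = if (k : ℕ) + 1 = n then 0 else (k : ℕ) + 1 := by
    split_ifs with h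
    · rw [h, Nat.mod_self]
    · exact Nat.mod_eq_of_lt (by omega)
  rw [cycleGraph_adj', ← val_eq_add_one_mod_iff hn, ← val_eq_add_one_mod_iff hn, mod_eq, mod_eq]
  split_ifs <;> omega

theorem tadpoleGraph_adj_iff_val {i j : Fin n} :
    (tadpoleGraph n).Adj i j ↔ (i : ℕ) + 1 = j ∨ (j : ℕ) + 1 = i ∨
      (i : ℕ) = 0 ∧ (j : ℕ) = 2 ∨ (j : ℕ) = 0 ∧ (i : ℕ) = 2 := by
  rw [tadpoleGraph, fromRel_adj, Ne, Fin.ext_iff]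
  omega

/-- The permutation of `Fin n` that fixes `0` and `1` and reverses the order of the other
elements. -/
def revFromTwo (n : ℕ) : Equiv.Perm (Fin n) :=
  Function.Involutive.toPerm
    (fun i ↦ ⟨if (i : ℕ) < 2 then i else n + 1 - i, by split_ifs <;> omega⟩)
    fun i ↦ by ext; grind

theorem val_revFromTwo (i : Fin n) :
    (revFromTwo n i : ℕ) = if (i : ℕ) < 2 then (i : ℕ) else n + 1 - i := rfl

-- Without the vertex `0` the two graphs coincide; without the vertex `1` they are paths, the
-- second one with `2, …, n - 1` in the reverse order.
theorem inducedCubeCount_indepGraph_cycleGraph (hn : 2 ≤ n) (k : ℕ) :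
    inducedCubeCount (indepGraph (cycleGraph n)) k =
      inducedCubeCount (indepGraph (tadpoleGraph n)) k := by
  let v : Fin n := ⟨0, by omega⟩
  let w : Fin n := ⟨1, by omega⟩
  have hv : revFromTwo n v = v := Fin.ext (val_revFromTwo v)
  refine inducedCubeCount_indepGraph_congr
    ((permSetsThrough (revFromTwo n) hv).subtypeEquiv fun s ↦ ?_)
    (fun s ↦ ncard_permSetsThrough _ hv s.1) k
  refine (isIndepSet_permSetsThrough_iff (w := w) hv ?_ ?_ ?_ ?_).symm
  all_goals
    simp only [cycleGraph_adj_iff_val hn, tadpoleGraph_adj_iff_val, val_revFromTwo, Ne,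
      Fin.ext_iff, v, w]
    grind

end Tadpole

section Fence

open SimpleGraph

variable {P : Type*} [PartialOrder P] {n : ℕ} {c d c' : HexCell} {h : Fin n → HexCell}

theorem HexArc.not_hexArc (hcd : HexArc c d) : ¬ HexArc d c := by
  simp only [HexArc, Prod.ext_iff, Prod.fst_sub, Prod.snd_sub] at *
  omega

-- The three arc vectors sum to zero, so two distinct consecutive ones are followed by an arc back
-- to the starting cell.
theorem HexArc.sub_eq_sub (hcd : HexArc c d) (hdc' : HexArc d c') (hadj : ¬ HexAdj c c') :
    c' - d = d - c := by
  simp only [HexAdj, HexArc, Prod.ext_iff, Prod.fst_sub, Prod.snd_sub] at *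
  omega

theorem IsLucasene.val_eq_of_hexArc (hh : IsLucasene h) {i j k : Fin n}
    (hij : HexArc (h i) (h j)) (hjk : HexArc (h j) (h k)) :
    (j : ℕ) = 1 ∧ ((i : ℕ) = 0 ∧ (k : ℕ) = 2 ∨ (i : ℕ) = 2 ∧ (k : ℕ) = 0) := by
  have hki : k ≠ i := by
    rintro rfl
    exact hij.not_hexArc hjk
  have adj_ij := (hh.adj_iff i j).1 (.inl hij)
  have adj_jk := (hh.adj_iff j k).1 (.inl hjk)
  have hstraight : h k - h j = h j - h i :=
    hij.sub_eq_sub hjk fun hadj ↦ by have := (hh.adj_iff i k).1 hadj; omega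
  obtain hij' | hji' := adj_ij
  · have := (hh.linear_iff i j k hij' (by omega)).1 hstraight
    omega
  · have hstraight' : h i - h j = h j - h k := by
      rw [← neg_sub (h j), ← hstraight, neg_sub]
    have := (hh.linear_iff k j i (by omega) hji').1 hstraight'
    omega

theorem IsLucasene.hexArc_or_hexArc (hh : IsLucasene h) {i j k : Fin n} (hi : (i : ℕ) = 0)
    (hj : (j : ℕ) = 1) (hk : (k : ℕ) = 2) :
    HexArc (h i) (h j) ∧ HexArc (h j) (h k) ∨ HexArc (h k) (h j) ∧ HexArc (h j) (h i) := by
  have hadj : HexAdj (h i) (h j) := (hh.adj_iff i j).2 (.inl (by omega))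
  have hstraight : h k - h j = h j - h i := (hh.linear_iff i j k (by omega) (by omega)).2 hi
  refine hadj.imp (fun harc ↦ ⟨harc, ?_⟩) (fun harc ↦ ⟨?_, harc⟩)
  · rwa [HexArc, hstraight]
  · rwa [HexArc, ← neg_sub, hstraight, neg_sub]

theorem IsLucasene.exists_hexArc_hexArc_iff (hh : IsLucasene h) {i j : Fin n} :
    (∃ k, HexArc (h i) (h k) ∧ HexArc (h k) (h j) ∨ HexArc (h j) (h k) ∧ HexArc (h k) (h i)) ↔
      (i : ℕ) = 0 ∧ (j : ℕ) = 2 ∨ (j : ℕ) = 0 ∧ (i : ℕ) = 2 := by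
  constructor
  · rintro ⟨k, ⟨hik, hkj⟩ | ⟨hjk, hki⟩⟩
    · have := (hh.val_eq_of_hexArc hik hkj).2
      tauto
    · have := (hh.val_eq_of_hexArc hjk hki).2
      tauto
  · rintro (⟨hi, hj⟩ | ⟨hj, hi⟩)
    · exact ⟨⟨1, by omega⟩, hh.hexArc_or_hexArc hi rfl hj⟩
    · exact ⟨⟨1, by omega⟩, (hh.hexArc_or_hexArc hj rfl hi).symm⟩

theorem lt_iff_covBy_or_exists_covBy_covBy [IsStronglyAtomic P]
    (hP : ∀ a b c d : P, a ⋖ b → b ⋖ c → ¬ c ⋖ d) {a b : P} :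
    a < b ↔ a ⋖ b ∨ ∃ c, a ⋖ c ∧ c ⋖ b := by
  constructor
  · intro hab
    obtain ⟨c, hac, hcb⟩ := exists_covBy_le_of_lt hab
    obtain rfl | hcb := hcb.eq_or_lt
    · exact .inl hac
    obtain ⟨d, hcd, hdb⟩ := exists_covBy_le_of_lt hcb
    obtain rfl | hdb := hdb.eq_or_lt
    · exact .inr ⟨c, hac, hcd⟩
    obtain ⟨x, hdx, -⟩ := exists_covBy_le_of_lt hdb
    exact (hP _ _ _ _ hac hcd hdx).elim
  · rintro (hab | ⟨c, hac, hcb⟩)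
    · exact hab.lt
    · exact hac.lt.trans hcb.lt

theorem lt_iff_hexArc_or_exists (hh : IsLucasene h) (e : Fin n ≃ P)
    (he : ∀ i j, e j ⋖ e i ↔ HexArc (h i) (h j)) {i j : Fin n} :
    e j < e i ↔ HexArc (h i) (h j) ∨ ∃ k, HexArc (h i) (h k) ∧ HexArc (h k) (h j) := by
  have : Finite P := .of_equiv _ e
  rw [lt_iff_covBy_or_exists_covBy_covBy, he, ← e.exists_congr_right]
  · simp only [he, and_comm]
  · simp only [e.surjective.forall, he]
    intro a b c d hab hbc hcd
    have := hh.val_eq_of_hexArc hcd hbc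
    have := hh.val_eq_of_hexArc hbc hab
    omega

theorem IsLFence.finite (hP : IsLFence n P) : Finite P := by
  obtain ⟨_, _, e, _⟩ := hP
  exact .of_equiv _ e

theorem IsLFence.nonempty_tadpoleGraph_iso (hP : IsLFence n P) :
    Nonempty (tadpoleGraph n ≃g comparabilityGraph P) := by
  obtain ⟨h, hh, e, he⟩ := hP
  refine ⟨e, fun {i j} ↦ ?_⟩
  calc e i < e j ∨ e j < e i
      ↔ HexAdj (h i) (h j) ∨
          ∃ k, HexArc (h i) (h k) ∧ HexArc (h k) (h j) ∨
            HexArc (h j) (h k) ∧ HexArc (h k) (h i) := by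
        rw [lt_iff_hexArc_or_exists hh e he, lt_iff_hexArc_or_exists hh e he, HexAdj, exists_or,
          or_comm, or_or_or_comm]
    _ ↔ (tadpoleGraph n).Adj i j := by
        rw [hh.adj_iff, hh.exists_hexArc_hexArc_iff, tadpoleGraph_adj_iff_val, or_assoc]

theorem IsLFence.exists_lt_lt (hP : IsLFence n P) (hn : 3 ≤ n) : ∃ a b c : P, a < b ∧ b < c := by
  obtain ⟨h, hh, e, he⟩ := hP
  obtain ⟨h₀₁, h₁₂⟩ | ⟨h₂₁, h₁₀⟩ := hh.hexArc_or_hexArc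
    (i := ⟨0, by omega⟩) (j := ⟨1, by omega⟩) (k := ⟨2, hn⟩) rfl rfl rfl
  · exact ⟨_, _, _, ((he _ _).2 h₁₂).lt, ((he _ _).2 h₀₁).lt⟩
  · exact ⟨_, _, _, ((he _ _).2 h₁₀).lt, ((he _ _).2 h₂₁).lt⟩

end Fence

section NonIsomorphism

open SimpleGraph Set
open scoped symmDiff

variable {V P : Type*} [PartialOrder P] {n : ℕ}

theorem not_forall_isLowerSet_symmDiff_singleton {a b c : P} (hab : a < b) (hbc : b < c)
    {s : Set P} (hs : IsLowerSet s) : ¬ ∀ p, IsLowerSet (s ∆ {p}) := by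
  intro h
  by_cases hb : b ∈ s
  · have : a ∈ s ∆ {a} := h a hab.le (.inl ⟨hb, hab.ne'⟩)
    simp [mem_symmDiff, hs hab.le hb] at this
  · have hc : c ∉ s := fun hc ↦ hb (hs hbc.le hc)
    have : b ∈ s ∆ {c} := h c hbc.le (.inr ⟨rfl, hc⟩)
    simp [mem_symmDiff, hb, hbc.ne] at this

-- The empty independent set has as many neighbours as there are vertices, so its image would be a
-- lower set of `P` in which every single element may be added or removed.
theorem isEmpty_indepGraph_iso_hasse_lowerSet [Finite P] (H : SimpleGraph V) (e : V ≃ P)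
    {a b c : P} (hab : a < b) (hbc : b < c) : IsEmpty (indepGraph H ≃g hasse (LowerSet P)) := by
  have : Finite V := .of_equiv P e.symm
  refine ⟨fun f ↦ ?_⟩
  let φ : indepGraph H ↪g hasse (Set P) := (lowerSetEmbedding P).comp f.toEmbedding
  have isLowerSet_φ s : IsLowerSet (φ s) := (f s).lower
  let empty : {s : Set V // H.IsIndepSet s} := ⟨∅, by simp⟩
  let single (v : V) : {s : Set V // H.IsIndepSet s} := ⟨{v}, by simp⟩
  have adj_single v : (indepGraph H).Adj empty (single v) :=
    hasse_set_adj_iff.2 ⟨v, (bot_symmDiff {v}).symm⟩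
  choose d hd using fun v ↦ hasse_set_adj_iff.1 (φ.map_adj_iff.2 (adj_single v))
  have d_injective : Function.Injective d := fun v w hvw ↦ singleton_injective <|
    congrArg Subtype.val (φ.injective (by rw [hd, hd, hvw]) : single v = single w)
  have d_surjective : Function.Surjective d := d_injective.surjective_of_finite e
  refine not_forall_isLowerSet_symmDiff_singleton hab hbc (isLowerSet_φ empty) fun p ↦ ?_
  obtain ⟨v, rfl⟩ := d_surjective p
  exact hd v ▸ isLowerSet_φ (single v)

theorem isEmpty_lucasCube_iso_hasse (hn : 3 ≤ n) (hP : IsLFence n P) :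
    IsEmpty (lucasCube n ≃g hasse (MatchableLucasLattice P)) := by
  obtain ⟨a, b, c, hab, hbc⟩ := hP.exists_lt_lt hn
  obtain ⟨f⟩ := nonempty_lucasCube_iso_indepGraph (n := n) (by omega)
  have := hP.finite
  obtain ⟨_, _, e, _⟩ := hP
  exact ⟨fun g ↦ (isEmpty_indepGraph_iso_hasse_lowerSet (cycleGraph n) e hab hbc).false
    ((hasseIso upperSetIsoLowerSet).comp (g.comp f.symm))⟩

theorem inducedCubeCount_lucasCube (hn : 2 ≤ n) (hP : IsLFence n P) (k : ℕ) :
    inducedCubeCount (lucasCube n) k =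
      inducedCubeCount (hasse (MatchableLucasLattice P)) k := by
  obtain ⟨f⟩ := nonempty_lucasCube_iso_indepGraph hn
  have := hP.finite
  obtain ⟨g⟩ := hP.nonempty_tadpoleGraph_iso
  calc inducedCubeCount (lucasCube n) k
      = inducedCubeCount (indepGraph (cycleGraph n)) k := inducedCubeCount_congr f k
    _ = inducedCubeCount (indepGraph (tadpoleGraph n)) k :=
        inducedCubeCount_indepGraph_cycleGraph hn k
    _ = inducedCubeCount (indepGraph (comparabilityGraph P)) k :=
        inducedCubeCount_indepGraph_of_iso g k
    _ = inducedCubeCount (hasse (LowerSet P)) k := (inducedCubeCount_hasse_lowerSet P k).symm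
    _ = inducedCubeCount (hasse (MatchableLucasLattice P)) k :=
        (inducedCubeCount_congr (hasseIso upperSetIsoLowerSet) k).symm

end NonIsomorphism

theorem mainTheorem12 (n : ℕ) (hn : 2 ≤ n) {Ξ : Type*} [PartialOrder Ξ] (hΞ : IsLFence n Ξ) :
    -- `Λ_n` and `Ω_n` have the same number of induced cubes of every dimension
    (∀ k : ℕ, inducedCubeCount (lucasCube n) k =
      inducedCubeCount (SimpleGraph.hasse (MatchableLucasLattice Ξ)) k) ∧
    -- but they are different graphs
    (3 ≤ n → IsEmpty (lucasCube n ≃g SimpleGraph.hasse (MatchableLucasLattice Ξ))) ∧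
    -- even case
    (∀ m : ℕ, 1 ≤ m → n = 2 * m →
      ∃ (L : Type) (_ : DistribLattice L), Finite L ∧
        Nonempty (SimpleGraph.hasse L ≃g lucasCube n) ∧
        (2 ≤ m → IsEmpty (L ≃o MatchableLucasLattice Ξ))) ∧
    -- odd case
    (∀ m : ℕ, 1 ≤ m → n = 2 * m + 1 →
      ∀ (L : Type*) [DistribLattice L] [Finite L],
        IsEmpty (SimpleGraph.hasse L ≃g lucasCube n)) := by
  obtain ⟨f⟩ := nonempty_lucasCube_iso_indepGraph hn
  refine ⟨inducedCubeCount_lucasCube hn hΞ, fun hn3 ↦ isEmpty_lucasCube_iso_hasse hn3 hΞ, ?_, ?_⟩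
  · intro m _ hnm
    have hbip : (SimpleGraph.cycleGraph n).IsBipartite :=
      (isBipartite_cycleGraph_iff hn).2 (hnm ▸ even_two_mul m)
    obtain ⟨L, _, _, ⟨g⟩⟩ := exists_distribLattice_iso_indepGraph hbip
    refine ⟨L, inferInstance, inferInstance, ⟨f.symm.comp g⟩, fun hm ↦ ⟨fun o ↦ ?_⟩⟩
    exact (isEmpty_lucasCube_iso_hasse (by omega) hΞ).false
      ((hasseIso o).comp (g.symm.comp f))
  · intro m _ hnm L _ _
    refine ⟨fun g ↦ ?_⟩
    have hbip : (SimpleGraph.cycleGraph n).IsBipartite :=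
      isBipartite_of_hasse_iso_indepGraph (f.comp g)
    have heven : Even n := (isBipartite_cycleGraph_iff hn).1 hbip
    exact Nat.not_even_two_mul_add_one m (hnm ▸ heven)
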